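/- Let $K\ge 1$ and let $0<p<\infty$; put $q=\frac{2p}{p+1}$. Let $\mathcal P_1,\dots,\mathcal P_K$ be probability distributions on $\mathbb R$ with means $\mu_k$ and variances $\sigma_k^2$. Suppose each $\mathcal P_k$ is $\sigma$-subgaussian, i.e. $\mathbb E_{X\sim\mathcal P_k}[e^{t(X-\mu_k)}]\le e^{t^2\sigma^2/2}$ for all $t\in\mathbb R$, where $\sigma>0$ is known, and suppose $\sigma_k\ge\underline\sigma$ for all $k$, where $\underline\sigma>0$ is known. For each $k$ let $X_{k,1},X_{k,2},\dots$ be i.i.d. observations from $\mathcal P_k$. For $n=(n_1,\dots,n_K)$ with positive entries let $$R_p(n)=\Big(\sum_{k=1}^K\Big(\frac{\sigma_k^2}{n_k}\Big)^p\Big)^{1/p},\qquad n_k^*=\frac{\sigma_k^q}{\sum_{j}\sigma_j^q}\,T,\qquad \Sigma_r=\sum_{k=1}^K\sigma_k^r,\qquad \lambda=\frac{\underline\sigma^q}{\underline\sigma^q+(K-1)\sigma^q}.$$ Algorithm 1 with horizon $T$ (the number of rounds) and initial length $\tau=\lfloor\lambda T\rfloor$ works as follows. Phase 1: choose each alternative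 $k$ for $\tau$ rounds, and compute the unbiased sample variances $\hat\sigma_{k,\tau}^2=\frac1{\tau-1}\sum_{i=1}^{\tau}\big(X_{k,i}-\frac1\tau\sum_{j=1}^{\tau}X_{k,j}\big)^2$. Phase 2: put $\lambda_{k,\tau}=\hat\sigma_{k,\tau}^q/\sum_j\hat\sigma_{j,\tau}^q$ (and $\lambda_{k,\tau}=0$ if the denominator vanishes), and for $k=1,\dots,K$ in turn choose alternative $k$ for $\max\{\lfloor\lambda_{k,\tau}T\rfloor-\tau,0\}$ further rounds; stop as soon as $T$ rounds have been played. Let $n_{\pi_1}$ be the vector of the numbers of times that the alternatives are chosen. Then there is a function $g$ with $g(T)=o(T^{-2})$ as $T\to\infty$, depending only on $K,p,\sigma,\underline\sigma,\sigma_1,\dots,\sigma_K$, such that for every $T$ with $\tau\ge 2$ all entries of $n_{\pi_1}$ are positive, $R_p(n_{\pi_1})-R_p(n^*)$ is integrable, and $$\mathbb E\big[R_p(n_{\pi_1})-R_p(n^*)\big]\le 24\,\sigma^4F_1^p\,T^{-2}\log T+g(T),\qquad F_1^p=\frac{p^2\,(\Sigma_q)^{1/p}\,\Sigma_{q-4}}{\lambda\,(p+1)}.$$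 -/

import Mathlib

open MeasureTheory ProbabilityTheory Filter Asymptotics
open scoped NNReal

noncomputable section

namespace GroupMean

/-- The exponent `q = 2p / (p + 1)` attached to a finite `p`. -/
def qExp (p : ℝ) : ℝ := 2 * p / (p + 1)

/-- The power sum `Σ_r = ∑ₖ σₖ ^ r` of the standard deviations `s k = σₖ`. -/
def powerSum {K : ℕ} (s : Fin K → ℝ) (r : ℝ) : ℝ := ∑ k, s k ^ r

/-- The objective `R_p(n) = (∑ₖ (σₖ² / nₖ) ^ p) ^ (1 / p)` for finite `p`. -/
def objective {K : ℕ} (p : ℝ) (s : Fin K → ℝ) (n : Fin K → ℝ) : ℝ :=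
  (∑ k, (s k ^ 2 / n k) ^ p) ^ (1 / p)

/-- The optimal (real-valued) allocation `nₖ* = σₖ ^ q / (∑ⱼ σⱼ ^ q) * T`. -/
def optAlloc {K : ℕ} (p : ℝ) (s : Fin K → ℝ) (T : ℕ) (k : Fin K) : ℝ :=
  s k ^ qExp p / powerSum s (qExp p) * T

/-- The fraction `λ = σlow ^ q / (σlow ^ q + (K - 1) σ ^ q)` of the horizon given to each
alternative in the first phase. -/
def phaseOneFrac (K : ℕ) (p σ σlow : ℝ) : ℝ :=
  σlow ^ qExp p / (σlow ^ qExp p + ((K : ℝ) - 1) * σ ^ qExp p)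

/-- The length `τ = ⌊λ T⌋` of the first phase, per alternative. -/
def phaseOneLength (K : ℕ) (p σ σlow : ℝ) (T : ℕ) : ℕ :=
  ⌊phaseOneFrac K p σ σlow * T⌋₊

/-- The sample mean of the first `n` terms of `x`. -/
def sampleMean (x : ℕ → ℝ) (n : ℕ) : ℝ := (∑ i ∈ Finset.range n, x i) / n

/-- The sample variance `(1 / (n - 1)) ∑ (xᵢ - x̄)²` of the first `n` terms of `x`. -/
def sampleVar (x : ℕ → ℝ) (n : ℕ) : ℝ :=
  (∑ i ∈ Finset.range n, (x i - sampleMean x n) ^ 2) / ((n : ℝ) - 1)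

/-- The allocation weight `λ_{k,τ} = σ̂_{k,τ} ^ q / ∑ⱼ σ̂_{j,τ} ^ q` computed from the first `τ`
observations of each alternative; `x k t` is the observation number `t` (counted from `0`) of
alternative `k`. -/
def weight {K : ℕ} (p : ℝ) (x : Fin K → ℕ → ℝ) (τ : ℕ) (k : Fin K) : ℝ :=
  Real.sqrt (sampleVar (x k) τ) ^ qExp p / ∑ j, Real.sqrt (sampleVar (x j) τ) ^ qExp p

/-- The sequence of alternatives chosen by the non-adaptive algorithm with horizon `T`:
first every alternative `k = 1, …, K` is chosen for `τ` rounds; then, for `k = 1, …, K` in turn,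
alternative `k` is chosen for `⌊λ_{k,τ} T⌋ - τ` further rounds (no round if this number is
negative); the run is cut at the horizon, that is, after `T` rounds. -/
def schedule {K : ℕ} (p σ σlow : ℝ) (T : ℕ) (x : Fin K → ℕ → ℝ) : List (Fin K) :=
  ((List.finRange K).flatMap
      (fun k => List.replicate (phaseOneLength K p σ σlow T) k) ++
    (List.finRange K).flatMap
      (fun k => List.replicate
        (⌊weight p x (phaseOneLength K p σ σlow T) k * T⌋₊ - phaseOneLength K p σ σlow T) k)).take T

/-- The number of times that the algorithm chooses alternative `k` up to the horizon `T`. -/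
def alloc {K : ℕ} (p σ σlow : ℝ) (T : ℕ) (x : Fin K → ℕ → ℝ) (k : Fin K) : ℕ :=
  (schedule p σ σlow T x).count k

/-- The optimality gap `R_p(n) - R_p(n*)` of the algorithm's allocation `n`. -/
def gap {K : ℕ} (p σ σlow : ℝ) (s : Fin K → ℝ) (T : ℕ) (x : Fin K → ℕ → ℝ) : ℝ :=
  objective p s (fun k => (alloc p σ σlow T x k : ℝ)) - objective p s (optAlloc p s T)

/-- The constant `F = p² (Σ_q)^{1/p} Σ_{q-4} / (λ (p + 1))`. -/
def gapConst {K : ℕ} (p σ σlow : ℝ) (s : Fin K → ℝ) : ℝ :=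
  p ^ 2 * powerSum s (qExp p) ^ (1 / p) * powerSum s (qExp p - 4) /
    (phaseOneFrac K p σ σlow * (p + 1))

/-- A distribution on the line is `σ`-subgaussian (around its mean): the moment generating
function of the centred variable exists and is at most `exp (t² σ² / 2)` everywhere. -/
def IsSubgaussian (ν : Measure ℝ) (σ : ℝ) : Prop :=
  HasSubgaussianMGF (fun y => y - ∫ z, z ∂ν) (⟨σ ^ 2, sq_nonneg σ⟩ : ℝ≥0) ν

end GroupMean

end

/-! The expected gap is in fact at most `C / T ^ 2`, with `C` uniform over the distributions
(`GroupMean.integral_gap_le`). Since the coefficient of `T⁻² log T` is positive, that term alone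
dominates for large `T`, and `g` only has to repair finitely many horizons.

For the `T⁻²` bound, let `wₖ` be the optimal fractions and `uₖ = nₖ / (wₖ T)`. By the choice of `q`
the objective is a constant over `T` times `(∑ wₖ uₖ ^ (-p)) ^ (1 / p)` (`objective_eq`). Expanding
at `u = 1`, the linear term depends only on the unused share `1 - ∑ nₖ / T`, so the gap is governed
by that share and by `∑ wₖ (uₖ - 1)²` (`objective_sub_le`). The first phase keeps every `uₖ` above a
constant, so the expansion holds on every path and no concentration event is needed.

If `D` is the relative `ℓ¹` error of the estimated `σₖ ^ q`, the allocation is off by `O(D T + 1)`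
and the total falls short by at most `K + T D²` (`alloc_bounds`). As `q / 2 ≤ 1`, `D` is Lipschitz
in the sample variances. Hence the gap is at most a constant over `T` times `1 / T` plus the squared
variance errors (`gap_le`), whose means are `O(1 / τ) = O(1 / T)` (`integral_sampleVar_sub_sq_le`).
-/

namespace GroupMean

/-! ### Elementary inequalities for powers and normalised vectors. -/

section RealAnalysis

/-- Global Lipschitz-type estimate for a concave power. -/
lemma abs_rpow_sub_rpow_le {v : ℝ} (hv : 0 < v) {V : ℝ} (hV : 0 ≤ V) {r : ℝ} (hr0 : 0 ≤ r)
    (hr1 : r ≤ 1) : |V ^ r - v ^ r| ≤ v ^ (r - 1) * |V - v| := by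
  obtain ⟨x, rfl⟩ : ∃ x, V = v * x := ⟨V / v, by field_simp⟩
  have hx : 0 ≤ x := nonneg_of_mul_nonneg_right hV hv
  -- For `0 ≤ r ≤ 1` the number `x ^ r` lies between `1` and `x`.
  have key : |x ^ r - 1| ≤ |x - 1| := by
    rcases le_total x 1 with h | h
    · rw [abs_of_nonpos (by linarith [Real.rpow_le_one hx h hr0]), abs_of_nonpos (by linarith)]
      rcases hx.eq_or_lt with rfl | hx'
      · linarith [Real.rpow_nonneg (le_refl (0 : ℝ)) r]
      · have := Real.rpow_le_rpow_of_exponent_ge hx' h hr1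
        rw [Real.rpow_one] at this
        linarith
    · have := Real.rpow_le_rpow_of_exponent_le h hr1
      rw [Real.rpow_one] at this
      rw [abs_of_nonneg (by linarith [Real.one_le_rpow h hr0]), abs_of_nonneg (by linarith)]
      linarith
  have e1 : (v * x) ^ r - v ^ r = v ^ r * (x ^ r - 1) := by
    rw [Real.mul_rpow hv.le hx]; ring
  have e2 : v ^ (r - 1) * |v * x - v| = v ^ r * |x - 1| := by
    rw [show v * x - v = v * (x - 1) by ring, abs_mul, abs_of_pos hv, Real.rpow_sub_one hv.ne']
    field_simp
  rw [e1, e2, abs_mul, abs_of_pos (Real.rpow_pos_of_pos hv r)]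
  exact mul_le_mul_of_nonneg_left key (Real.rpow_pos_of_pos hv r).le

/-- Second-order upper bound at `1` for `u ↦ u ^ (-p)`, valid away from the origin. -/
lemma rpow_neg_le_quadratic {p c u : ℝ} (hp : 0 < p) (hc : 0 < c) (hc1 : c ≤ 1) (hu : c ≤ u) :
    u ^ (-p) ≤ 1 - p * (u - 1) + p * (p + 1) * c ^ (-(p + 1)) * (u - 1) ^ 2 := by
  have hu0 : 0 < u := hc.trans_le hu
  set b := u ^ (p + 1) with hb
  have hb0 : 0 < b := Real.rpow_pos_of_pos hu0 _
  have hd0 : 0 < c ^ (p + 1) := Real.rpow_pos_of_pos hc _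
  have hd1 : c ^ (p + 1) ≤ 1 := Real.rpow_le_one hc.le hc1 (by linarith)
  have hdb : c ^ (p + 1) ≤ b := Real.rpow_le_rpow hc.le hu (by linarith)
  -- Writing `u ^ (-p)` as `u / u ^ (p + 1)` gives an exponent above `1`, so that Bernoulli applies
  -- at both `u` and `u⁻¹` for every `p > 0`.
  have bern : 1 + (p + 1) * (u - 1) ≤ b := by
    have := one_add_mul_self_le_rpow_one_add (s := u - 1) (by linarith) (p := p + 1) (by linarith)
    simpa using this
  have bern' : 1 + (p + 1) * (u⁻¹ - 1) ≤ b⁻¹ := by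
    have := one_add_mul_self_le_rpow_one_add (s := u⁻¹ - 1) (by linarith [inv_pos.2 hu0])
      (p := p + 1) (by linarith)
    rw [add_sub_cancel, Real.inv_rpow hu0.le] at this
    exact this
  have e : u ^ (-p) = u / b := by
    rw [hb, Real.rpow_neg hu0.le, Real.rpow_add_one hu0.ne']
    field_simp
  rw [e, Real.rpow_neg hc.le]
  have h1 : u / b ≤ 1 - p * (u - 1) * b⁻¹ := by
    rw [div_le_iff₀ hb0]
    have : (1 - p * (u - 1) * b⁻¹) * b = b - p * (u - 1) := by field_simp
    rw [this]; linarith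
  -- Replacing `b⁻¹` by `1` in the linear term of `h1` costs only a quadratic error.
  have h2 : (1 - b⁻¹) * (u - 1) ≤ (p + 1) * (c ^ (p + 1))⁻¹ * (u - 1) ^ 2 := by
    rcases le_total u 1 with h | h
    · have h3 : b⁻¹ - 1 ≤ (p + 1) * (c ^ (p + 1))⁻¹ * (1 - u) := by
        have : b⁻¹ - 1 = (1 - b) * b⁻¹ := by field_simp
        rw [this]
        have h4 : b⁻¹ ≤ (c ^ (p + 1))⁻¹ := inv_anti₀ hd0 hdb
        calc (1 - b) * b⁻¹ ≤ ((p + 1) * (1 - u)) * b⁻¹ := by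
              apply mul_le_mul_of_nonneg_right _ (inv_pos.2 hb0).le; linarith
          _ ≤ ((p + 1) * (1 - u)) * (c ^ (p + 1))⁻¹ := by
              apply mul_le_mul_of_nonneg_left h4
              apply mul_nonneg <;> linarith
          _ = _ := by ring
      nlinarith [mul_le_mul_of_nonneg_right h3 (sub_nonneg.2 h)]
    · have h3 : 1 - b⁻¹ ≤ (p + 1) * (c ^ (p + 1))⁻¹ * (u - 1) := by
        have h4 : 1 - u⁻¹ ≤ u - 1 := by
          have : 1 - u⁻¹ = (u - 1) * u⁻¹ := by field_simp
          rw [this]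
          exact mul_le_of_le_one_right (by linarith) (inv_le_one_of_one_le₀ h)
        have h5 : 1 ≤ (c ^ (p + 1))⁻¹ := (one_le_inv₀ hd0).2 hd1
        calc 1 - b⁻¹ ≤ (p + 1) * (1 - u⁻¹) := by linarith
          _ ≤ (p + 1) * (u - 1) := by gcongr
          _ ≤ (p + 1) * (u - 1) * (c ^ (p + 1))⁻¹ :=
              le_mul_of_one_le_right (mul_nonneg (by linarith) (by linarith)) h5
          _ = _ := by ring
      nlinarith [mul_le_mul_of_nonneg_right h3 (sub_nonneg.2 h)]
  have h6 := mul_le_mul_of_nonneg_left h2 hp.le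
  linarith

/-- Linear upper bound for a power on a bounded range. -/
lemma rpow_sub_one_le {r B x Y : ℝ} (hr : 0 ≤ r) (hY : 0 ≤ Y) (hYB : Y ≤ B) (hx : 0 ≤ x)
    (hYx : Y - 1 ≤ x) : Y ^ r - 1 ≤ max r 1 * max B 1 ^ max r 1 * x := by
  have hm : (1 : ℝ) ≤ max r 1 := le_max_right _ _
  have hC : 0 ≤ max r 1 * max B 1 ^ max r 1 := by positivity
  rcases le_total Y 1 with h | h
  · have := Real.rpow_le_one hY h hr
    have := mul_nonneg hC hx
    linarith
  · have hY0 : 0 < Y := by linarith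
    -- For `Y ≥ 1` a larger exponent only increases the power, and `m ≥ 1` makes Bernoulli available
    -- at `Y⁻¹`.
    set m := max r 1
    have h1 : Y ^ r ≤ Y ^ m := Real.rpow_le_rpow_of_exponent_le h (le_max_left _ _)
    have h2 : Y ^ m ≤ max B 1 ^ m :=
      Real.rpow_le_rpow hY (hYB.trans (le_max_left _ _)) (by linarith)
    have hb : 0 < Y ^ m := Real.rpow_pos_of_pos hY0 _
    have bern : 1 + m * (Y⁻¹ - 1) ≤ (Y ^ m)⁻¹ := by
      have := one_add_mul_self_le_rpow_one_add (s := Y⁻¹ - 1) (by linarith [inv_pos.2 hY0])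
        (p := m) hm
      rw [add_sub_cancel, Real.inv_rpow hY0.le] at this
      exact this
    have h4 : 1 - Y⁻¹ ≤ Y - 1 := by
      have : 1 - Y⁻¹ = (Y - 1) * Y⁻¹ := by field_simp
      rw [this]
      exact mul_le_of_le_one_right (by linarith) (inv_le_one_of_one_le₀ h)
    calc Y ^ r - 1 ≤ Y ^ m - 1 := by linarith
      _ = Y ^ m * (1 - (Y ^ m)⁻¹) := by field_simp
      _ ≤ Y ^ m * (m * (Y - 1)) := by
          apply mul_le_mul_of_nonneg_left _ hb.le
          nlinarith
      _ ≤ max B 1 ^ m * (m * x) := by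
          apply mul_le_mul h2 _ (mul_nonneg (by linarith) (by linarith)) (by positivity)
          apply mul_le_mul_of_nonneg_left hYx (by linarith)
      _ = _ := by ring

/-- Normalising a nonnegative vector is Lipschitz near a vector of positive sum. -/
lemma abs_div_sum_sub_div_sum_le {ι : Type*} [Fintype ι] {A a : ι → ℝ} (hA : ∀ i, 0 ≤ A i)
    (ha : 0 < ∑ i, a i) (k : ι) :
    |A k / ∑ i, A i - a k / ∑ i, a i| ≤ 2 * ((∑ i, |A i - a i|) / ∑ i, a i) := by
  have hsum : |∑ i, a i - ∑ i, A i| ≤ ∑ i, |A i - a i| := by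
    rw [← Finset.sum_sub_distrib]
    refine (Finset.abs_sum_le_sum_abs _ _).trans (le_of_eq ?_)
    exact Finset.sum_congr rfl fun i _ => abs_sub_comm _ _
  have hk : |A k - a k| ≤ ∑ i, |A i - a i| :=
    Finset.single_le_sum (f := fun i => |A i - a i|) (fun i _ => abs_nonneg _) (Finset.mem_univ k)
  have hAk : A k ≤ ∑ i, A i := Finset.single_le_sum (fun i _ => hA i) (Finset.mem_univ k)
  set S := ∑ i, A i
  set s := ∑ i, a i
  set d := ∑ i, |A i - a i|
  have hx0 : 0 ≤ A k / S := div_nonneg (hA k) ((hA k).trans hAk)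
  have hx1 : A k / S ≤ 1 := div_le_one_of_le₀ hAk ((hA k).trans hAk)
  -- Only the fixed sum `s` is left to divide by: the random quotient enters as a factor in `[0,
  -- 1]`. If `S = 0`, all `A i` vanish and the identity persists.
  have e : A k / S - a k / s = (A k / S * (s - S) + (A k - a k)) / s := by
    have : A k / S * S = A k := by
      rcases eq_or_ne S 0 with h | h
      · have : A k = 0 := le_antisymm (h ▸ hAk) (hA k)
        simp [this]
      · field_simp
    rw [mul_sub, this]
    field_simp
    ring
  rw [e, abs_div, abs_of_pos ha, ← mul_div_assoc]
  gcongr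
  calc |A k / S * (s - S) + (A k - a k)| ≤ |A k / S * (s - S)| + |A k - a k| := abs_add_le _ _
    _ ≤ 1 * d + d := by
        rw [abs_mul, abs_of_nonneg hx0]
        gcongr
    _ = 2 * d := by ring

/-- The normalised vector sums to `1` up to the square of the perturbation, also when the
denominator vanishes. -/
lemma one_sub_le_sum_div_sum {ι : Type*} [Fintype ι] {A a : ι → ℝ}
    (ha : 0 < ∑ i, a i) :
    1 - ((∑ i, |A i - a i|) / ∑ i, a i) ^ 2 ≤ ∑ k, A k / ∑ i, A i := by
  rw [← Finset.sum_div]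
  rcases eq_or_ne (∑ i, A i) 0 with h | h
  · rw [h, div_zero]
    have : ∑ i, a i ≤ ∑ i, |A i - a i| := by
      calc ∑ i, a i = ∑ i, -(A i - a i) := by
            simp [Finset.sum_sub_distrib, h]
        _ ≤ _ := Finset.sum_le_sum fun i _ => neg_le_abs _
    have h1 : 1 ≤ (∑ i, |A i - a i|) / ∑ i, a i := (one_le_div ha).2 this
    nlinarith
  · rw [div_self h]
    linarith [sq_nonneg ((∑ i, |A i - a i|) / ∑ i, a i)]

end RealAnalysis

end GroupMean

namespace GroupMean

/-! ### Counting the rounds of the truncated schedule. -/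

section Allocation

variable {K : ℕ}

lemma sum_count_eq_length (l : List (Fin K)) : ∑ k, l.count k = l.length := by
  have := Multiset.sum_count_eq_card (s := Finset.univ) (m := (l : Multiset (Fin K)))
    (fun a _ => Finset.mem_univ a)
  simpa using this

lemma count_flatMap_replicate (f : Fin K → ℕ) (k : Fin K) :
    ((List.finRange K).flatMap fun j => List.replicate (f j) j).count k = f k := by
  rw [List.count_flatMap]
  have : (List.map (List.count k ∘ fun j => List.replicate (f j) j) (List.finRange K)).sum
      = ∑ j, if j = k then f j else 0 := by
    rw [← List.sum_ofFn, List.ofFn_eq_map]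
    congr 2
    funext j
    simp [List.count_replicate]
  rw [this]
  simp

lemma length_flatMap_replicate (f : Fin K → ℕ) :
    ((List.finRange K).flatMap fun j => List.replicate (f j) j).length = ∑ k, f k := by
  rw [← sum_count_eq_length]
  simp only [count_flatMap_replicate]

variable {p σ σlow : ℝ} {T : ℕ} {x : Fin K → ℕ → ℝ}

/-- The number of rounds that the algorithm would give to an alternative without a horizon. -/
noncomputable def target (p σ σlow : ℝ) (T : ℕ) (x : Fin K → ℕ → ℝ) (k : Fin K) : ℕ :=
  max ⌊weight p x (phaseOneLength K p σ σlow T) k * T⌋₊ (phaseOneLength K p σ σlow T)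

lemma alloc_le_target (k : Fin K) : alloc p σ σlow T x k ≤ target p σ σlow T x k := by
  refine ((List.take_sublist _ _).count_le k).trans ?_
  rw [List.count_append, count_flatMap_replicate, count_flatMap_replicate]
  unfold target
  omega

lemma sum_alloc : ∑ k, alloc p σ σlow T x k = min T (∑ k, target p σ σlow T x k) := by
  unfold alloc
  rw [sum_count_eq_length, schedule, List.length_take, List.length_append,
    length_flatMap_replicate, length_flatMap_replicate, ← Finset.sum_add_distrib]
  congr 1
  refine Finset.sum_congr rfl fun k _ => ?_
  unfold target
  omega

/-- The first phase fits into the horizon, so the cut can only remove rounds of the second. -/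
lemma phaseOneLength_le_alloc (h : K * phaseOneLength K p σ σlow T ≤ T) (k : Fin K) :
    phaseOneLength K p σ σlow T ≤ alloc p σ σlow T x k := by
  unfold alloc schedule
  rw [List.take_append, List.count_append, List.take_of_length_le, count_flatMap_replicate]
  · omega
  · rw [length_flatMap_replicate]
    simpa using h

/-- No alternative loses more than the whole overshoot, whatever the order of play. With truncated
subtraction this includes the case of no overshoot. -/
lemma target_sub_alloc_le (k : Fin K) :
    target p σ σlow T x k - alloc p σ σlow T x k ≤ ∑ j, target p σ σlow T x j - T := by
  have h1 : ∑ j, target p σ σlow T x j =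
      ∑ j, (target p σ σlow T x j - alloc p σ σlow T x j) + ∑ j, alloc p σ σlow T x j := by
    rw [← Finset.sum_add_distrib]
    exact Finset.sum_congr rfl fun j _ => by have := alloc_le_target (p := p) (σ := σ)
                                              (σlow := σlow) (T := T) (x := x) j; omega
  have h2 : target p σ σlow T x k - alloc p σ σlow T x k ≤
      ∑ j, (target p σ σlow T x j - alloc p σ σlow T x j) :=
    Finset.single_le_sum (f := fun j => target p σ σlow T x j - alloc p σ σlow T x j)
      (fun _ _ => Nat.zero_le _) (Finset.mem_univ k)
  rw [sum_alloc] at h1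
  omega

/-- The algorithm's allocation is close to a reference allocation `w T` as soon as the weights
are. -/
lemma alloc_bounds {w : Fin K → ℝ} {D : ℝ} (hD : 0 ≤ D)
    (hw1 : ∑ k, w k = 1)
    (hτ : ∀ k, (phaseOneLength K p σ σlow T : ℝ) ≤ w k * T)
    (hweight0 : ∀ k, 0 ≤ weight p x (phaseOneLength K p σ σlow T) k)
    (hweight : ∀ k, |weight p x (phaseOneLength K p σ σlow T) k - w k| ≤ 2 * D)
    (hsum : 1 - D ^ 2 ≤ ∑ k, weight p x (phaseOneLength K p σ σlow T) k) :
    (∀ k, |(alloc p σ σlow T x k : ℝ) - w k * T| ≤ (2 + 2 * K) * D * T + 1) ∧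
      T - K - T * D ^ 2 ≤ ∑ k, (alloc p σ σlow T x k : ℝ) := by
  have hT : (0 : ℝ) ≤ T := Nat.cast_nonneg T
  have hK : (0 : ℝ) ≤ K := Nat.cast_nonneg K
  have hwk := fun k => abs_le.1 (hweight k)
  have hmul : ∀ k, |weight p x (phaseOneLength K p σ σlow T) k * T - w k * T| ≤ 2 * D * T := by
    intro k
    rw [← sub_mul, abs_mul, abs_of_nonneg hT]
    exact mul_le_mul_of_nonneg_right (hweight k) hT
  -- The maximum with the first-phase length costs nothing, because that length is at most `w k *
  -- T`.
  have hup : ∀ k, (target p σ σlow T x k : ℝ) ≤ w k * T + 2 * D * T := by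
    intro k
    unfold target
    rw [Nat.cast_max]
    have h1 := Nat.floor_le (mul_nonneg (hweight0 k) hT)
    have h2 := abs_le.1 (hmul k)
    have h3 : 0 ≤ 2 * D * T := by positivity
    exact max_le (by linarith) (by linarith [hτ k])
  have hlo : ∀ k, weight p x (phaseOneLength K p σ σlow T) k * T - 1 ≤ target p σ σlow T x k := by
    intro k
    unfold target
    rw [Nat.cast_max]
    exact (Nat.sub_one_lt_floor _).le.trans (le_max_left _ _)
  have hsumup : ∑ k, (target p σ σlow T x k : ℝ) ≤ T + 2 * K * D * T := by
    calc _ ≤ ∑ k, (w k * T + 2 * D * T) := Finset.sum_le_sum fun k _ => hup k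
      _ = (∑ k, w k) * T + K * (2 * D * T) := by
          rw [Finset.sum_add_distrib, Finset.sum_mul]; simp
      _ = _ := by rw [hw1]; ring
  refine ⟨fun k => ?_, ?_⟩
  · have hdiff : (target p σ σlow T x k : ℝ) - alloc p σ σlow T x k ≤ 2 * K * D * T := by
      have h := target_sub_alloc_le (p := p) (σ := σ) (σlow := σlow) (T := T) (x := x) k
      have h0 : 0 ≤ 2 * K * D * T := by positivity
      have hcast : ((∑ j, target p σ σlow T x j : ℕ) : ℝ) ≤ T + 2 * K * D * T := by
        push_cast; exact hsumup
      rcases Nat.le_total (∑ j, target p σ σlow T x j) T with h' | h'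
      · have : target p σ σlow T x k ≤ alloc p σ σlow T x k := by omega
        have : (target p σ σlow T x k : ℝ) ≤ alloc p σ σlow T x k := by exact_mod_cast this
        linarith
      · have : target p σ σlow T x k + T ≤
            ∑ j, target p σ σlow T x j + alloc p σ σlow T x k := by omega
        have : (target p σ σlow T x k : ℝ) + T ≤
            (∑ j, target p σ σlow T x j : ℕ) + alloc p σ σlow T x k := by exact_mod_cast this
        linarith
    have hle : (alloc p σ σlow T x k : ℝ) ≤ target p σ σlow T x k := by
      exact_mod_cast alloc_le_target k
    have h0 : 0 ≤ 2 * K * D * T := by positivity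
    have h2 := abs_le.1 (hmul k)
    rw [abs_le]
    constructor
    · linarith [hlo k]
    · linarith [hup k]
  · have h : ((∑ k, alloc p σ σlow T x k : ℕ) : ℝ) =
        min (T : ℝ) (∑ k, target p σ σlow T x k : ℕ) := by
      rw [sum_alloc, Nat.cast_min]
    push_cast at h
    rw [h]
    refine le_min (by nlinarith [mul_nonneg hT (sq_nonneg D)]) ?_
    calc (T : ℝ) - K - T * D ^ 2 = (1 - D ^ 2) * T - K := by ring
      _ ≤ (∑ k, weight p x (phaseOneLength K p σ σlow T) k) * T - K := by gcongr
      _ = ∑ k, (weight p x (phaseOneLength K p σ σlow T) k * T - 1) := by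
          rw [Finset.sum_sub_distrib, Finset.sum_mul]; simp
      _ ≤ _ := Finset.sum_le_sum fun k _ => hlo k

end Allocation

end GroupMean

namespace GroupMean

/-! ### Second and fourth moments of subgaussian variables. -/

section Moments

variable {Ω : Type*} [MeasurableSpace Ω] {P : Measure Ω}

/-- A subgaussian variable has fourth moment at most a multiple of the squared parameter. -/
lemma fourth_moment_le {Y : Ω → ℝ} {c : ℝ≥0} (h : HasSubgaussianMGF Y c P) (hc : 0 < c) :
    ∫ ω, Y ω ^ 4 ∂P ≤ 96 * (c : ℝ) ^ 2 := by
  have hc' : (0 : ℝ) < c := hc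
  -- At this scale both exponential moments are at most `exp (1 / 2) ≤ 2`; with `y ^ 4 ≤ 4! * exp
  -- |y|` this gives `96 = 24 * (2 + 2)`.
  set t := (Real.sqrt c)⁻¹ with ht
  have hsq : 0 < Real.sqrt c := Real.sqrt_pos.2 hc'
  have ht2 : t ^ 2 = (c : ℝ)⁻¹ := by rw [ht, inv_pow, Real.sq_sqrt hc'.le]
  have hbound : ∀ ω, Y ω ^ 4 ≤
      24 * (c : ℝ) ^ 2 * (Real.exp (t * Y ω) + Real.exp (-t * Y ω)) := by
    intro ω
    have h1 := Real.pow_div_factorial_le_exp |t * Y ω| (abs_nonneg _) 4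
    have h2 : Real.exp |t * Y ω| ≤ Real.exp (t * Y ω) + Real.exp (-t * Y ω) := by
      rw [neg_mul]
      rcases abs_cases (t * Y ω) with h | h <;> rw [h.1]
      · linarith [Real.exp_pos (-(t * Y ω))]
      · linarith [Real.exp_pos (t * Y ω)]
    have h3 : |t * Y ω| ^ 4 = Y ω ^ 4 / (c : ℝ) ^ 2 := by
      rw [Even.pow_abs (by decide), mul_pow, show t ^ 4 = (t ^ 2) ^ 2 by ring, ht2]
      field_simp
    rw [h3] at h1
    have h4 : ((Nat.factorial 4 : ℕ) : ℝ) = 24 := by norm_num [Nat.factorial]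
    rw [h4] at h1
    have h5 := h1.trans h2
    rw [div_div, div_le_iff₀ (by positivity)] at h5
    linarith
  have hexp : ∀ r : ℝ, r ^ 2 = (c : ℝ)⁻¹ → ∫ ω, Real.exp (r * Y ω) ∂P ≤ 2 := by
    intro r hr
    refine (h.mgf_le r).trans ?_
    rw [hr, mul_inv_cancel₀ hc'.ne']
    rw [← Real.log_le_log_iff (Real.exp_pos _) (by norm_num), Real.log_exp]
    linarith [Real.log_two_gt_d9]
  calc ∫ ω, Y ω ^ 4 ∂P
      ≤ ∫ ω, 24 * (c : ℝ) ^ 2 * (Real.exp (t * Y ω) + Real.exp (-t * Y ω)) ∂P := by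
        refine integral_mono_of_nonneg (ae_of_all _ fun ω => by positivity) ?_
          (ae_of_all _ hbound)
        exact ((h.integrable_exp_mul t).add (h.integrable_exp_mul (-t))).const_mul _
    _ = 24 * (c : ℝ) ^ 2 *
        (∫ ω, Real.exp (t * Y ω) ∂P + ∫ ω, Real.exp (-t * Y ω) ∂P) := by
        rw [integral_const_mul, integral_add (h.integrable_exp_mul t) (h.integrable_exp_mul (-t))]
    _ ≤ 24 * (c : ℝ) ^ 2 * (2 + 2) := by
        gcongr
        · exact hexp t ht2
        · exact hexp (-t) (by rw [neg_sq, ht2])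
    _ = _ := by ring

lemma one_add_sq_div_two_le_cosh (y : ℝ) : 1 + y ^ 2 / 2 ≤ Real.cosh y := by
  have h1 : Real.cosh y = 1 + 2 * Real.sinh (y / 2) ^ 2 := by
    have := Real.cosh_two_mul (y / 2)
    rw [mul_div_cancel₀ y two_ne_zero, Real.cosh_sq] at this
    linarith
  have h2 : (y / 2) ^ 2 ≤ Real.sinh (y / 2) ^ 2 := by
    rw [sq_le_sq, Real.abs_sinh]
    exact Real.self_le_sinh_iff.2 (abs_nonneg _)
  rw [h1]
  nlinarith

/-- A subgaussian variable has second moment at most its parameter. -/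
lemma second_moment_le [IsProbabilityMeasure P] {Y : Ω → ℝ} {c : ℝ≥0} (h : HasSubgaussianMGF Y c P) :
    ∫ ω, Y ω ^ 2 ∂P ≤ c := by
  set v := ∫ ω, Y ω ^ 2 ∂P
  have hint : Integrable (fun ω => Y ω ^ 2) P := by
    have := (h.memLp 2).integrable_sq
    exact this
  -- Averaging over `t` and `-t` removes the odd terms; comparing the coefficients of `t ^ 2` as `t
  -- → 0` then yields `v ≤ c`.
  have key : ∀ t : ℝ, 1 + t ^ 2 * v / 2 ≤ Real.exp (c * t ^ 2 / 2) := by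
    intro t
    have hi1 := h.integrable_exp_mul t
    have hi2 := h.integrable_exp_mul (-t)
    calc 1 + t ^ 2 * v / 2 = ∫ ω, (1 + t ^ 2 / 2 * Y ω ^ 2) ∂P := by
          rw [integral_add (integrable_const _) (hint.const_mul _), integral_const_mul]
          simp
          ring
      _ ≤ ∫ ω, 2⁻¹ * (Real.exp (t * Y ω) + Real.exp (-t * Y ω)) ∂P := by
          refine integral_mono ((integrable_const _).add (hint.const_mul _))
            ((hi1.add hi2).const_mul _) fun ω => ?_
          have := one_add_sq_div_two_le_cosh (t * Y ω)
          rw [Real.cosh_eq] at this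
          simp only [neg_mul]
          rw [mul_pow] at this
          linarith
      _ = 2⁻¹ * (mgf Y P t + mgf Y P (-t)) := by
          rw [integral_const_mul, integral_add hi1 hi2]; rfl
      _ ≤ 2⁻¹ * (Real.exp (c * t ^ 2 / 2) + Real.exp (c * t ^ 2 / 2)) := by
          have h2 := h.mgf_le (-t)
          rw [neg_sq] at h2
          gcongr
          exact h.mgf_le t
      _ = _ := by ring
  by_contra! hlt
  have hc : (0 : ℝ) ≤ c := c.2
  -- choose `c t² / 2 = x` small, so that `exp x ≤ 1 + x + x²` contradicts `key`
  set d := v - c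
  have hd : 0 < d := by simp only [d]; linarith
  set x : ℝ := min (1 / ((c : ℝ) + 1)) (d / ((c : ℝ) + 1) ^ 2)
  have hx0 : 0 < x := lt_min (by positivity) (by positivity)
  have hx1 : c * x ≤ 1 := by
    calc (c : ℝ) * x ≤ c * (1 / (c + 1)) := by gcongr; exact min_le_left _ _
      _ ≤ 1 := by rw [mul_one_div, div_le_one (by positivity)]; linarith
  have hx2 : (c : ℝ) ^ 2 * x < d := by
    calc (c : ℝ) ^ 2 * x ≤ c ^ 2 * (d / (c + 1) ^ 2) := by gcongr; exact min_le_right _ _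
      _ < d := by
        rw [mul_div_assoc', div_lt_iff₀ (by positivity)]
        nlinarith
  have h1 := key (Real.sqrt (2 * x))
  rw [Real.sq_sqrt (by positivity)] at h1
  have h2 : Real.exp (c * (2 * x) / 2) ≤ 1 + c * x + (c * x) ^ 2 := by
    have := Real.abs_exp_sub_one_sub_id_le (x := c * x)
      (by rw [abs_of_nonneg (by positivity)]; exact hx1)
    rw [show c * (2 * x) / 2 = c * x by ring]
    linarith [(abs_le.1 this).2]
  have h3 : x * v ≤ x * (c + c ^ 2 * x) := by nlinarith
  have h4 := le_of_mul_le_mul_left h3 hx0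
  simp only [d] at hx2
  linarith

end Moments

/-! ### Mean square error of the sample variance. -/

section SampleVariance

/-- The sum of squared deviations from the sample mean, in centred coordinates. -/
lemma sampleVar_eq (x : ℕ → ℝ) (m : ℝ) {n : ℕ} (hn : n ≠ 0) :
    sampleVar x n = (∑ i ∈ Finset.range n, (x i - m) ^ 2 -
      (∑ i ∈ Finset.range n, (x i - m)) ^ 2 / n) / ((n : ℝ) - 1) := by
  have hn' : (n : ℝ) ≠ 0 := Nat.cast_ne_zero.2 hn
  unfold sampleVar
  congr 1
  set S := ∑ i ∈ Finset.range n, (x i - m) with hS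
  have hmean : sampleMean x n = S / n + m := by
    unfold sampleMean
    have : S = ∑ i ∈ Finset.range n, x i - n * m := by
      rw [hS, Finset.sum_sub_distrib]; simp
    rw [this]
    field_simp
    ring
  rw [hmean]
  have : ∀ i, (x i - (S / n + m)) ^ 2 = (x i - m) ^ 2 - 2 * (S / n) * (x i - m) + (S / n) ^ 2 := by
    intro i; ring
  simp only [this]
  rw [Finset.sum_add_distrib, Finset.sum_sub_distrib, ← Finset.mul_sum, ← hS]
  simp
  field_simp
  ring

lemma sampleVar_nonneg (x : ℕ → ℝ) (n : ℕ) (hn : 1 ≤ n) : 0 ≤ sampleVar x n := by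
  unfold sampleVar
  have : (1 : ℝ) ≤ n := by exact_mod_cast hn
  exact div_nonneg (Finset.sum_nonneg fun _ _ => sq_nonneg _) (by linarith)

/-- The error splits into a sum of centred squares and the correction for the estimated mean. The
factor `8` is `2` from `(a - b)² ≤ 2a² + 2b²` times `4` from `n ≤ 2(n - 1)`. -/
lemma sampleVar_sub_sq_le (x : ℕ → ℝ) (m v : ℝ) {n : ℕ} (hn : 2 ≤ n) :
    (sampleVar x n - v) ^ 2 ≤ 8 / (n : ℝ) ^ 2 *
      ((∑ i ∈ Finset.range n, ((x i - m) ^ 2 - v)) ^ 2 +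
        (2 * (∑ i ∈ Finset.range n, (x i - m)) ^ 4 / (n : ℝ) ^ 2 + 2 * v ^ 2)) := by
  have hn' : (2 : ℝ) ≤ n := by exact_mod_cast hn
  set S := ∑ i ∈ Finset.range n, (x i - m) with hS
  set Z := ∑ i ∈ Finset.range n, ((x i - m) ^ 2 - v) with hZ
  have hZ' : ∑ i ∈ Finset.range n, (x i - m) ^ 2 = Z + n * v := by
    rw [hZ, Finset.sum_sub_distrib]; simp
  have e : sampleVar x n - v = (Z - (S ^ 2 / n - v)) / ((n : ℝ) - 1) := by
    rw [sampleVar_eq x m (by omega), hZ', ← hS]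
    have : (n : ℝ) - 1 ≠ 0 := by linarith
    field_simp
    ring
  have h1 : (Z - (S ^ 2 / n - v)) ^ 2 ≤ 2 * (Z ^ 2 + (2 * S ^ 4 / (n : ℝ) ^ 2 + 2 * v ^ 2)) := by
    have : 2 * S ^ 4 / (n : ℝ) ^ 2 = 2 * (S ^ 2 / n) ^ 2 := by field_simp
    rw [this]
    nlinarith [sq_nonneg (Z + (S ^ 2 / n - v)), sq_nonneg (S ^ 2 / n + v)]
  have h2 : (1 : ℝ) / ((n : ℝ) - 1) ^ 2 ≤ 4 / (n : ℝ) ^ 2 := by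
    rw [div_le_div_iff₀ (by nlinarith) (by positivity)]
    nlinarith
  rw [e, div_pow, div_eq_mul_one_div]
  calc _ ≤ 2 * (Z ^ 2 + (2 * S ^ 4 / (n : ℝ) ^ 2 + 2 * v ^ 2)) * (4 / (n : ℝ) ^ 2) :=
        mul_le_mul h1 h2 (by positivity) (by positivity)
    _ = _ := by ring

variable {Ω : Type*} [MeasurableSpace Ω] {P : Measure Ω} [IsProbabilityMeasure P]

/-- Mean square error of the sample variance of independent subgaussian variables. -/
lemma integral_sampleVar_sub_sq_le {X : ℕ → Ω → ℝ} {m v : ℝ} {c : ℝ≥0} (hc : 0 < c)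
    (hind : iIndepFun X P) (hsub : ∀ i, HasSubgaussianMGF (fun ω => X i ω - m) c P)
    (hvar : ∀ i, ∫ ω, (X i ω - m) ^ 2 ∂P = v) {n : ℕ} (hn : 2 ≤ n) :
    Integrable (fun ω => (sampleVar (fun i => X i ω) n - v) ^ 2) P ∧
      ∫ ω, (sampleVar (fun i => X i ω) n - v) ^ 2 ∂P ≤ 2400 * (c : ℝ) ^ 2 / n := by
  have hn' : (2 : ℝ) ≤ n := by exact_mod_cast hn
  have hY4 : ∀ {Y : Ω → ℝ} {d : ℝ≥0}, HasSubgaussianMGF Y d P →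
      MemLp (fun ω => Y ω ^ 2) 2 P := by
    intro Y d h
    have h4 : Integrable (fun ω => Y ω ^ 4) P := by
      have := (h.memLp 4).integrable_norm_pow (p := 4) (by norm_num)
      refine this.congr (ae_of_all _ fun ω => ?_)
      simp only [Real.norm_eq_abs]
      exact Even.pow_abs (by decide) _
    refine (memLp_two_iff_integrable_sq (h.aestronglyMeasurable.pow 2)).2 ?_
    refine h4.congr (ae_of_all _ fun ω => ?_)
    simp only [Pi.pow_apply]
    ring
  have hv0 : 0 ≤ v := by rw [← hvar 0]; exact integral_nonneg fun ω => sq_nonneg _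
  have hvc : v ≤ c := by rw [← hvar 0]; exact second_moment_le (hsub 0)
  set Z : ℕ → Ω → ℝ := fun i ω => (X i ω - m) ^ 2 - v with hZ
  have hZL : ∀ i, MemLp (Z i) 2 P := fun i => (hY4 (hsub i)).sub (memLp_const v)
  have hZint : ∀ i, ∫ ω, Z i ω ∂P = 0 := by
    intro i
    rw [hZ]
    simp only
    rw [integral_sub ((hY4 (hsub i)).integrable (by norm_num)) (integrable_const _), hvar i]
    simp
  have hZvar : ∀ i, Var[Z i; P] ≤ 96 * (c : ℝ) ^ 2 := by
    intro i
    have h1 : Var[Z i; P] = Var[fun ω => (X i ω - m) ^ 2; P] :=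
      variance_sub_const (hY4 (hsub i)).aestronglyMeasurable v
    rw [h1]
    refine (variance_le_expectation_sq (hY4 (hsub i)).aestronglyMeasurable).trans ?_
    refine le_trans (le_of_eq ?_) (fourth_moment_le (hsub i) hc)
    refine integral_congr_ae (ae_of_all _ fun ω => ?_)
    simp only [Pi.pow_apply]
    ring
  have hZind : iIndepFun Z P := by
    exact hind.comp (fun _ y => (y - m) ^ 2 - v) fun _ => by fun_prop
  have hsumL : MemLp (fun ω => ∑ i ∈ Finset.range n, Z i ω) 2 P :=
    memLp_finsetSum _ fun i _ => hZL i
  have hsumZ : ∫ ω, (∑ i ∈ Finset.range n, Z i ω) ^ 2 ∂P ≤ n * (96 * (c : ℝ) ^ 2) := by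
    have h0 : ∫ ω, ∑ i ∈ Finset.range n, Z i ω ∂P = 0 := by
      rw [integral_finsetSum _ fun i _ => (hZL i).integrable (by norm_num)]
      simp [hZint]
    rw [← variance_of_integral_eq_zero hsumL.aestronglyMeasurable.aemeasurable h0]
    have h1 := IndepFun.variance_sum (s := Finset.range n) (fun i _ => hZL i)
      (fun i _ j _ hij => hZind.indepFun hij)
    have h2 : (fun ω => ∑ i ∈ Finset.range n, Z i ω) = ∑ i ∈ Finset.range n, Z i := by
      ext ω; simp
    rw [h2, h1]
    calc _ ≤ ∑ i ∈ Finset.range n, 96 * (c : ℝ) ^ 2 := Finset.sum_le_sum fun i _ => hZvar i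
      _ = _ := by simp
  -- The sum is again subgaussian, so its fourth moment is `O(n²)` and the mean correction
  -- contributes only `O(n⁻²)`.
  have hS : HasSubgaussianMGF (fun ω => ∑ i ∈ Finset.range n, (X i ω - m)) (n * c) P := by
    have := HasSubgaussianMGF.sum_of_iIndepFun (c := fun _ => c) (s := Finset.range n)
      (hind.comp (fun _ y => y - m) fun _ => by fun_prop) (fun i _ => hsub i)
    simpa using this
  have hS4 : ∫ ω, (∑ i ∈ Finset.range n, (X i ω - m)) ^ 4 ∂P ≤ 96 * (n * c : ℝ) ^ 2 := by
    have := fourth_moment_le hS (mul_pos (by positivity) hc)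
    simpa using this
  have hS4i : Integrable (fun ω => (∑ i ∈ Finset.range n, (X i ω - m)) ^ 4) P := by
    refine (hY4 hS).integrable_sq.congr (ae_of_all _ fun ω => ?_)
    ring
  set B : Ω → ℝ := fun ω => 8 / (n : ℝ) ^ 2 * ((∑ i ∈ Finset.range n, Z i ω) ^ 2 +
        (2 * (∑ i ∈ Finset.range n, (X i ω - m)) ^ 4 / (n : ℝ) ^ 2 + 2 * v ^ 2)) with hB
  have hi1 : Integrable (fun ω => 2 * (∑ i ∈ Finset.range n, (X i ω - m)) ^ 4 / (n : ℝ) ^ 2) P :=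
    (hS4i.const_mul 2).div_const _
  have hi2 : Integrable (fun ω => 2 * (∑ i ∈ Finset.range n, (X i ω - m)) ^ 4 / (n : ℝ) ^ 2 +
      2 * v ^ 2) P := hi1.add (integrable_const _)
  have hBi : Integrable B P := (hsumL.integrable_sq.add hi2).const_mul _
  have hle : ∀ ω, (sampleVar (fun i => X i ω) n - v) ^ 2 ≤ B ω := fun ω =>
    sampleVar_sub_sq_le (fun i => X i ω) m v hn
  have hXm : ∀ i, AEMeasurable (X i) P := fun i => by
    simpa using (hsub i).aemeasurable.add_const m
  refine ⟨hBi.mono' ?_ (ae_of_all _ fun ω => ?_), ?_⟩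
  · apply AEMeasurable.aestronglyMeasurable
    unfold sampleVar sampleMean
    fun_prop
  · rw [Real.norm_of_nonneg (sq_nonneg _)]
    exact hle ω
  · calc _ ≤ ∫ ω, B ω ∂P :=
          integral_mono_of_nonneg (ae_of_all _ fun ω => sq_nonneg _) hBi (ae_of_all _ hle)
      _ = 8 / (n : ℝ) ^ 2 * (∫ ω, (∑ i ∈ Finset.range n, Z i ω) ^ 2 ∂P +
          (2 * (∫ ω, (∑ i ∈ Finset.range n, (X i ω - m)) ^ 4 ∂P) / (n : ℝ) ^ 2 + 2 * v ^ 2)) := by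
          rw [hB, integral_const_mul, integral_add hsumL.integrable_sq hi2,
            integral_add hi1 (integrable_const _), integral_div, integral_const_mul]
          simp
      _ ≤ 8 / (n : ℝ) ^ 2 * (n * (96 * (c : ℝ) ^ 2) +
          (2 * (96 * (n * c : ℝ) ^ 2) / (n : ℝ) ^ 2 + 2 * (c : ℝ) ^ 2)) := by
          gcongr
      _ = 8 * (c : ℝ) ^ 2 * (96 * n + 194) / (n : ℝ) ^ 2 := by
          field_simp
          ring
      _ ≤ 2400 * (c : ℝ) ^ 2 / n := by
          rw [div_le_div_iff₀ (by positivity) (by positivity)]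
          have : 8 * (96 * (n : ℝ) + 194) ≤ 2400 * n := by linarith
          calc 8 * (c : ℝ) ^ 2 * (96 * n + 194) * n = (c : ℝ) ^ 2 * n * (8 * (96 * n + 194)) := by
                ring
            _ ≤ (c : ℝ) ^ 2 * n * (2400 * n) := by gcongr
            _ = _ := by ring

end SampleVariance

end GroupMean

namespace GroupMean

/-! ### Second-order expansion of the objective at the optimum. -/

section Objective

variable {K : ℕ} {p : ℝ} {s : Fin K → ℝ}

/-- The optimal fraction of the horizon for an alternative. -/
noncomputable def optFrac (p : ℝ) (s : Fin K → ℝ) (k : Fin K) : ℝ :=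
  s k ^ qExp p / powerSum s (qExp p)

lemma powerSum_pos (hK : 1 ≤ K) (hs : ∀ k, 0 < s k) (r : ℝ) : 0 < powerSum s r := by
  have : Nonempty (Fin K) := ⟨⟨0, hK⟩⟩
  exact Finset.sum_pos (fun k _ => Real.rpow_pos_of_pos (hs k) r) Finset.univ_nonempty

lemma optFrac_pos (hK : 1 ≤ K) (hs : ∀ k, 0 < s k) (k : Fin K) : 0 < optFrac p s k :=
  div_pos (Real.rpow_pos_of_pos (hs k) _) (powerSum_pos hK hs _)

lemma sum_optFrac (hK : 1 ≤ K) (hs : ∀ k, 0 < s k) : ∑ k, optFrac p s k = 1 := by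
  unfold optFrac
  rw [← Finset.sum_div]
  exact div_self (powerSum_pos hK hs (qExp p)).ne'

/-- The objective in terms of the relative deviations from the optimal allocation. -/
lemma objective_eq (hK : 1 ≤ K) (hp : 0 < p) (hs : ∀ k, 0 < s k) {T : ℝ} (hT : 0 < T)
    {n : Fin K → ℝ} (hn : ∀ k, 0 < n k) :
    objective p s n = powerSum s (qExp p) ^ ((p + 1) / p) / T *
      (∑ k, optFrac p s k * (n k / (optFrac p s k * T)) ^ (-p)) ^ (1 / p) := by
  set S := powerSum s (qExp p) with hS
  have hS0 : 0 < S := powerSum_pos hK hs _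
  have hterm : ∀ k, (s k ^ 2 / n k) ^ p =
      S ^ (p + 1) / T ^ p * (optFrac p s k * (n k / (optFrac p s k * T)) ^ (-p)) := by
    intro k
    have hw := optFrac_pos (p := p) hK hs k
    have hb : s k ^ 2 / (optFrac p s k * T) = s k ^ (2 - qExp p) * S / T := by
      rw [optFrac, ← hS, Real.rpow_sub (hs k), Real.rpow_two]
      have := Real.rpow_pos_of_pos (hs k) (qExp p)
      field_simp
    -- This identity singles out `q`: it makes the `p`-th powers at the optimum proportional to the
    -- fractions themselves.
    have he : (2 - qExp p) * p = qExp p := by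
      unfold qExp
      have : p + 1 ≠ 0 := by linarith
      field_simp
      ring
    have hb' : (s k ^ 2 / (optFrac p s k * T)) ^ p = S ^ (p + 1) / T ^ p * optFrac p s k := by
      rw [hb, Real.div_rpow (mul_nonneg (Real.rpow_nonneg (hs k).le _) hS0.le) hT.le,
        Real.mul_rpow (Real.rpow_nonneg (hs k).le _) hS0.le, ← Real.rpow_mul (hs k).le, he,
        optFrac, ← hS, Real.rpow_add_one hS0.ne']
      field_simp
    have hu : 0 < n k / (optFrac p s k * T) := div_pos (hn k) (mul_pos hw hT)
    have e : s k ^ 2 / n k = s k ^ 2 / (optFrac p s k * T) * (n k / (optFrac p s k * T))⁻¹ := by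
      have := (hn k).ne'
      field_simp
    rw [e, Real.mul_rpow (by have := hs k; positivity) (inv_pos.2 hu).le, hb',
      Real.inv_rpow hu.le, Real.rpow_neg hu.le]
    ring
  unfold objective
  rw [Finset.sum_congr rfl fun k _ => hterm k, ← Finset.mul_sum, Real.mul_rpow]
  · congr 1
    rw [Real.div_rpow (by positivity) (by positivity), ← Real.rpow_mul hS0.le,
      ← Real.rpow_mul hT.le, mul_one_div, mul_one_div_cancel hp.ne', Real.rpow_one]
  · positivity
  · refine Finset.sum_nonneg fun k _ => mul_nonneg (optFrac_pos hK hs k).le ?_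
    exact Real.rpow_nonneg (div_nonneg (hn k).le
      (mul_nonneg (optFrac_pos hK hs k).le hT.le)) _

lemma objective_optAlloc (hK : 1 ≤ K) (hp : 0 < p) (hs : ∀ k, 0 < s k) {T : ℕ} (hT : 0 < T) :
    objective p s (optAlloc p s T) = powerSum s (qExp p) ^ ((p + 1) / p) / T := by
  have hT' : (0 : ℝ) < T := Nat.cast_pos.2 hT
  have h : ∀ k, 0 < optFrac p s k * T := fun k => mul_pos (optFrac_pos hK hs k) hT'
  have := objective_eq hK hp hs hT' h
  simp only [div_self (h _).ne', Real.one_rpow, mul_one, sum_optFrac hK hs] at this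
  exact this

/-- Second-order bound for the optimality gap of an allocation. -/
lemma objective_sub_le (hK : 1 ≤ K) (hp : 0 < p) (hs : ∀ k, 0 < s k) {T : ℕ} (hT : 0 < T)
    {n : Fin K → ℝ} {c x : ℝ} (hc : 0 < c) (hc1 : c ≤ 1)
    (hn : ∀ k, c ≤ n k / (optFrac p s k * T)) (hx : 0 ≤ x)
    (hnx : p * (1 - (∑ k, n k) / T) + p * (p + 1) * c ^ (-(p + 1)) *
      ∑ k, optFrac p s k * (n k / (optFrac p s k * T) - 1) ^ 2 ≤ x) :
    objective p s n - objective p s (optAlloc p s T) ≤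
      powerSum s (qExp p) ^ ((p + 1) / p) / T *
        (max (1 / p) 1 * max (c ^ (-p)) 1 ^ max (1 / p) 1 * x) := by
  have hT' : (0 : ℝ) < T := Nat.cast_pos.2 hT
  have hw := optFrac_pos (p := p) hK hs
  have hwT : ∀ k, 0 < optFrac p s k * T := fun k => mul_pos (hw k) hT'
  have hn0 : ∀ k, 0 < n k := fun k => by
    have h1 := (le_div_iff₀ (hwT k)).1 (hn k)
    exact (mul_pos hc (hwT k)).trans_le h1
  have hS0 := powerSum_pos hK hs (qExp p)
  rw [objective_eq hK hp hs hT' hn0, objective_optAlloc hK hp hs hT]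
  set Y := ∑ k, optFrac p s k * (n k / (optFrac p s k * T)) ^ (-p) with hY
  have hu : ∀ k, 0 ≤ (n k / (optFrac p s k * T)) ^ (-p) := fun k =>
    Real.rpow_nonneg (div_nonneg (hn0 k).le (hwT k).le) _
  have hY0 : 0 ≤ Y := Finset.sum_nonneg fun k _ => mul_nonneg (hw k).le (hu k)
  have hYB : Y ≤ c ^ (-p) := by
    calc Y ≤ ∑ k, optFrac p s k * c ^ (-p) := by
          refine Finset.sum_le_sum fun k _ => mul_le_mul_of_nonneg_left ?_ (hw k).le
          exact Real.rpow_le_rpow_of_nonpos hc (hn k) (by linarith)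
      _ = c ^ (-p) := by rw [← Finset.sum_mul, sum_optFrac hK hs, one_mul]
  have hYx : Y - 1 ≤ x := by
    refine le_trans ?_ hnx
    have h1 : Y ≤ ∑ k, optFrac p s k * (1 - p * (n k / (optFrac p s k * T) - 1) +
        p * (p + 1) * c ^ (-(p + 1)) * (n k / (optFrac p s k * T) - 1) ^ 2) :=
      Finset.sum_le_sum fun k _ =>
        mul_le_mul_of_nonneg_left (rpow_neg_le_quadratic hp hc hc1 (hn k)) (hw k).le
    have h2 : ∀ k, optFrac p s k * (1 - p * (n k / (optFrac p s k * T) - 1) +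
        p * (p + 1) * c ^ (-(p + 1)) * (n k / (optFrac p s k * T) - 1) ^ 2) =
        (1 + p) * optFrac p s k - p / T * n k + p * (p + 1) * c ^ (-(p + 1)) *
          (optFrac p s k * (n k / (optFrac p s k * T) - 1) ^ 2) := by
      intro k
      -- The fractions cancel, so after summation the first-order term sees only the total number of
      -- rounds.
      have e : optFrac p s k * (n k / (optFrac p s k * T)) = n k / T := by
        have := (hw k).ne'
        field_simp
      linear_combination (-p) * e
    rw [Finset.sum_congr rfl fun k _ => h2 k, Finset.sum_add_distrib, Finset.sum_sub_distrib,
      ← Finset.mul_sum, ← Finset.mul_sum, ← Finset.mul_sum, sum_optFrac hK hs] at h1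
    have e2 : p * (1 - (∑ k, n k) / T) = p - p / T * ∑ k, n k := by ring
    rw [e2]
    linarith
  have h := rpow_sub_one_le (r := 1 / p) (by positivity) hY0 hYB hx hYx
  calc _ = powerSum s (qExp p) ^ ((p + 1) / p) / T * (Y ^ (1 / p) - 1) := by ring
    _ ≤ _ := by
      apply mul_le_mul_of_nonneg_left h
      positivity

end Objective

/-! ### Length of the first phase. -/

section PhaseOne

variable {K : ℕ} {p σ σlow : ℝ} {s : Fin K → ℝ} {T : ℕ}

lemma phaseOneFrac_pos (hK : 1 ≤ K) (hσ : 0 < σ) (hlow : 0 < σlow) :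
    0 < phaseOneFrac K p σ σlow := by
  have : (1 : ℝ) ≤ K := by exact_mod_cast hK
  have h1 := Real.rpow_pos_of_pos hlow (qExp p)
  have h2 := mul_nonneg (sub_nonneg.2 this) (Real.rpow_nonneg hσ.le (qExp p))
  exact div_pos h1 (by linarith)

/-- The extreme case is one deviation equal to `σlow` and all others equal to `σ`. Hence the first
phase never exceeds an optimal allocation. -/
lemma phaseOneFrac_le_optFrac (hK : 1 ≤ K) (hp : 0 < p) (hσ : 0 < σ) (hlow : 0 < σlow)
    (hs : ∀ k, σlow ≤ s k) (hsσ : ∀ k, s k ≤ σ) (k : Fin K) :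
    phaseOneFrac K p σ σlow ≤ optFrac p s k := by
  have hK' : (1 : ℝ) ≤ K := by exact_mod_cast hK
  have hs0 : ∀ k, 0 < s k := fun k => hlow.trans_le (hs k)
  have hq : 0 ≤ qExp p := by unfold qExp; positivity
  have h1 := Real.rpow_pos_of_pos hlow (qExp p)
  have h2 : 0 ≤ ((K : ℝ) - 1) * σ ^ qExp p :=
    mul_nonneg (sub_nonneg.2 hK') (Real.rpow_nonneg hσ.le (qExp p))
  have h3 : σlow ^ qExp p ≤ s k ^ qExp p := Real.rpow_le_rpow hlow.le (hs k) hq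
  have h4 : powerSum s (qExp p) ≤ s k ^ qExp p + ((K : ℝ) - 1) * σ ^ qExp p := by
    unfold powerSum
    rw [← Finset.add_sum_erase _ _ (Finset.mem_univ k)]
    gcongr
    refine (Finset.sum_le_card_nsmul _ _ (σ ^ qExp p) fun j _ =>
      Real.rpow_le_rpow (hs0 j).le (hsσ j) hq).trans (le_of_eq ?_)
    rw [Finset.card_erase_of_mem (Finset.mem_univ k), Finset.card_univ, Fintype.card_fin,
      nsmul_eq_mul, Nat.cast_sub hK, Nat.cast_one]
  unfold phaseOneFrac optFrac
  rw [div_le_div_iff₀ (by linarith) (powerSum_pos hK hs0 _)]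
  nlinarith [mul_le_mul_of_nonneg_left h4 h1.le, mul_le_mul_of_nonneg_right h3 h2]

lemma phaseOneLength_le (hK : 1 ≤ K) (hp : 0 < p) (hσ : 0 < σ) (hlow : 0 < σlow)
    (hs : ∀ k, σlow ≤ s k) (hsσ : ∀ k, s k ≤ σ) (k : Fin K) :
    (phaseOneLength K p σ σlow T : ℝ) ≤ optFrac p s k * T := by
  refine (Nat.floor_le (mul_nonneg (phaseOneFrac_pos hK hσ hlow).le (Nat.cast_nonneg T))).trans ?_
  gcongr
  exact phaseOneFrac_le_optFrac hK hp hσ hlow hs hsσ k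

lemma mul_phaseOneLength_le (hK : 1 ≤ K) (hp : 0 < p) (hσ : 0 < σ) (hlow : 0 < σlow)
    (hs : ∀ k, σlow ≤ s k) (hsσ : ∀ k, s k ≤ σ) :
    K * phaseOneLength K p σ σlow T ≤ T := by
  have h : ∑ _k : Fin K, (phaseOneLength K p σ σlow T : ℝ) ≤ ∑ k, optFrac p s k * T :=
    Finset.sum_le_sum fun k _ => phaseOneLength_le hK hp hσ hlow hs hsσ k
  rw [← Finset.sum_mul, sum_optFrac hK fun k => hlow.trans_le (hs k)] at h
  simp only [Finset.sum_const, Finset.card_univ, Fintype.card_fin, nsmul_eq_mul, one_mul] at h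
  exact_mod_cast h

/-- Rounding down a number that is at least `1` keeps half of it. This converts rates in `τ` into
rates in `T` for every admissible horizon. -/
lemma mul_le_phaseOneLength (h : 2 ≤ phaseOneLength K p σ σlow T) :
    phaseOneFrac K p σ σlow / 2 * T ≤ phaseOneLength K p σ σlow T := by
  have h1 : phaseOneFrac K p σ σlow * T < (phaseOneLength K p σ σlow T : ℝ) + 1 :=
    Nat.lt_floor_add_one _
  have h2 : (2 : ℝ) ≤ phaseOneLength K p σ σlow T := by exact_mod_cast h
  linarith

end PhaseOne

/-! ### Pathwise bound of the gap. -/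

section GapBound

variable {K : ℕ} {p σ σlow : ℝ} {s : Fin K → ℝ}

/-- As a function of the variance the weight is a power with exponent below `1`, so the Lipschitz
estimate holds even when a sample variance is near zero. -/
lemma sqrt_rpow_qExp {V : ℝ} (hV : 0 ≤ V) : Real.sqrt V ^ qExp p = V ^ (p / (p + 1)) := by
  rw [Real.sqrt_eq_rpow, ← Real.rpow_mul hV]
  congr 1
  unfold qExp
  ring

set_option maxHeartbeats 1000000 in
/-- Pathwise bound of the optimality gap by the squared errors of the variance estimators. -/
lemma gap_le (hK : 1 ≤ K) (hp : 0 < p) (hσ : 0 < σ) (hlow : 0 < σlow) (hs : ∀ k, σlow ≤ s k) :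
    ∃ C : ℝ, 0 ≤ C ∧ ∀ (T : ℕ) (x : Fin K → ℕ → ℝ), (∀ k, s k ≤ σ) →
      2 ≤ phaseOneLength K p σ σlow T →
      gap p σ σlow s T x ≤ C / T * (1 / T +
        ∑ k, (sampleVar (x k) (phaseOneLength K p σ σlow T) - s k ^ 2) ^ 2) := by
  have hs0 : ∀ k, 0 < s k := fun k => hlow.trans_le (hs k)
  have hS0 := powerSum_pos hK hs0 (qExp p)
  have hw0 := optFrac_pos (p := p) hK hs0
  have hl0 := phaseOneFrac_pos (p := p) hK hσ hlow
  set S := powerSum s (qExp p) with hS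
  -- `c` bounds the ratios `uₖ` below, `M` is the Lipschitz constant of the relative error `D`, `G`
  -- comes from the quadratic term, `H` from the outer power `1 / p`, and `N` collects the
  -- coefficients of `1 / T` and of the squared errors.
  set c := phaseOneFrac K p σ σlow / 2 with hc
  set M := (σlow ^ 2) ^ (p / (p + 1) - 1) / S with hM
  set G := p * (p + 1) * c ^ (-(p + 1)) with hG
  set W := ∑ k, 1 / optFrac p s k with hW
  set H := max (1 / p) 1 * max (c ^ (-p)) 1 ^ max (1 / p) 1 with hH
  set N := p * K + 2 * G * W + (p + 2 * G * W * (2 + 2 * K) ^ 2) * (M ^ 2 * K) with hN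
  have hc0 : 0 < c := by positivity
  have hM0 : 0 ≤ M := by positivity
  have hG0 : 0 ≤ G := by positivity
  have hW0 : 0 ≤ W := Finset.sum_nonneg fun k _ => (one_div_pos.2 (hw0 k)).le
  have hH0 : 0 ≤ H := by positivity
  have hN0 : 0 ≤ N := by positivity
  refine ⟨S ^ ((p + 1) / p) * (H * N), by positivity, fun T x hsσ hτ => ?_⟩
  set τ := phaseOneLength K p σ σlow T with hτdef
  set E := ∑ k, (sampleVar (x k) τ - s k ^ 2) ^ 2 with hE
  have hE0 : 0 ≤ E := Finset.sum_nonneg fun k _ => sq_nonneg _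
  have hT : 0 < T := by
    rcases Nat.eq_zero_or_pos T with h | h
    · simp [hτdef, phaseOneLength, h] at hτ
    · exact h
  have hT' : (1 : ℝ) ≤ T := by exact_mod_cast hT
  have hV0 : ∀ k, 0 ≤ sampleVar (x k) τ := fun k => sampleVar_nonneg _ _ (by omega)
  set A : Fin K → ℝ := fun k => Real.sqrt (sampleVar (x k) τ) ^ qExp p with hA
  set a : Fin K → ℝ := fun k => s k ^ qExp p with ha
  have hA0 : ∀ k, 0 ≤ A k := fun k => Real.rpow_nonneg (Real.sqrt_nonneg _) _
  have hsuma : 0 < ∑ k, a k := hS0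
  set D := (∑ k, |A k - a k|) / ∑ k, a k with hD
  have hD0 : 0 ≤ D := div_nonneg (Finset.sum_nonneg fun k _ => abs_nonneg _) hsuma.le
  have hr : p / (p + 1) ≤ 1 := (div_le_one (by linarith)).2 (by linarith)
  have hDM : D ≤ M * ∑ k, |sampleVar (x k) τ - s k ^ 2| := by
    have h1 : ∀ k, |A k - a k| ≤ (σlow ^ 2) ^ (p / (p + 1) - 1) *
        |sampleVar (x k) τ - s k ^ 2| := by
      intro k
      have e1 : A k = sampleVar (x k) τ ^ (p / (p + 1)) := sqrt_rpow_qExp (hV0 k)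
      have e2 : a k = (s k ^ 2) ^ (p / (p + 1)) := by
        rw [← sqrt_rpow_qExp (sq_nonneg _), Real.sqrt_sq (hs0 k).le]
      rw [e1, e2]
      refine (abs_rpow_sub_rpow_le (pow_pos (hs0 k) 2) (hV0 k) (by positivity) hr).trans ?_
      refine mul_le_mul_of_nonneg_right ?_ (abs_nonneg _)
      refine Real.rpow_le_rpow_of_nonpos (by positivity) ?_ (by linarith)
      exact pow_le_pow_left₀ hlow.le (hs k) 2
    calc D ≤ (∑ k, (σlow ^ 2) ^ (p / (p + 1) - 1) * |sampleVar (x k) τ - s k ^ 2|) / S := by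
          apply div_le_div_of_nonneg_right _ hS0.le
          exact Finset.sum_le_sum fun k _ => h1 k
      _ = _ := by rw [← Finset.mul_sum, hM]; ring
  have hD2 : D ^ 2 ≤ M ^ 2 * K * E := by
    calc D ^ 2 ≤ (M * ∑ k, |sampleVar (x k) τ - s k ^ 2|) ^ 2 := pow_le_pow_left₀ hD0 hDM 2
      _ = M ^ 2 * (∑ k, |sampleVar (x k) τ - s k ^ 2|) ^ 2 := by ring
      _ ≤ M ^ 2 * (K * E) := by
          gcongr
          have := sq_sum_le_card_mul_sum_sq (s := Finset.univ)
            (f := fun k => |sampleVar (x k) τ - s k ^ 2|)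
          simpa [sq_abs] using this
      _ = _ := by ring
  obtain ⟨hn, hsumn⟩ := alloc_bounds (p := p) (σ := σ) (σlow := σlow) (T := T) (x := x)
    (w := optFrac p s) hD0 (sum_optFrac hK hs0)
    (phaseOneLength_le hK hp hσ hlow hs hsσ)
    (fun k => div_nonneg (hA0 k) (Finset.sum_nonneg fun j _ => hA0 j))
    (fun k => abs_div_sum_sub_div_sum_le hA0 hsuma k)
    (one_sub_le_sum_div_sum hsuma)
  have hτn : ∀ k, (τ : ℝ) ≤ alloc p σ σlow T x k := fun k => by
    exact_mod_cast phaseOneLength_le_alloc (mul_phaseOneLength_le hK hp hσ hlow hs hsσ) k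
  have hw1 : ∀ k, optFrac p s k ≤ 1 := fun k => by
    rw [← sum_optFrac (p := p) hK hs0]
    exact Finset.single_le_sum (fun j _ => (hw0 j).le) (Finset.mem_univ k)
  have hcτ : c * T ≤ τ := mul_le_phaseOneLength hτ
  have hc1 : c ≤ 1 := by
    have k : Fin K := ⟨0, hK⟩
    have := (phaseOneFrac_le_optFrac hK hp hσ hlow hs hsσ k).trans (hw1 k)
    linarith
  -- Squared rounding errors are `O(T⁻²)`; weakening them is harmless, as the unused share already
  -- costs `K / T`.
  have hTi : 1 / (T : ℝ) ^ 2 ≤ 1 / T := by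
    apply one_div_le_one_div_of_le (by linarith)
    nlinarith
  have hwu : ∀ k, optFrac p s k * ((alloc p σ σlow T x k : ℝ) / (optFrac p s k * T) - 1) ^ 2 ≤
      2 * ((2 + 2 * K) ^ 2 * D ^ 2 + 1 / T) * (1 / optFrac p s k) := by
    intro k
    have hwk := hw0 k
    have e : (alloc p σ σlow T x k : ℝ) / (optFrac p s k * T) - 1 =
        (alloc p σ σlow T x k - optFrac p s k * T) / (optFrac p s k * T) := by
      field_simp
    have h1 : ((alloc p σ σlow T x k : ℝ) - optFrac p s k * T) ^ 2 ≤
        ((2 + 2 * K) * D * T + 1) ^ 2 := by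
      rw [← sq_abs]
      exact pow_le_pow_left₀ (abs_nonneg _) (hn k) 2
    calc _ = ((alloc p σ σlow T x k : ℝ) - optFrac p s k * T) ^ 2 / (T : ℝ) ^ 2 *
          (1 / optFrac p s k) := by rw [e]; field_simp
      _ ≤ (2 * (((2 + 2 * K) * D * T) ^ 2 + 1)) / (T : ℝ) ^ 2 * (1 / optFrac p s k) := by
          gcongr
          nlinarith [sq_nonneg ((2 + 2 * K) * D * T - 1)]
      _ = 2 * ((2 + 2 * K) ^ 2 * D ^ 2 + 1 / (T : ℝ) ^ 2) * (1 / optFrac p s k) := by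
          field_simp
      _ ≤ _ := by gcongr
  have key := objective_sub_le hK hp hs0 hT (n := fun k => (alloc p σ σlow T x k : ℝ)) (c := c)
    (x := N * (1 / T + E)) hc0 hc1
    (fun k => by
      rw [le_div_iff₀ (mul_pos (hw0 k) (by linarith))]
      calc c * (optFrac p s k * T) = optFrac p s k * (c * T) := by ring
        _ ≤ 1 * (c * T) := by gcongr; exact hw1 k
        _ ≤ _ := by rw [one_mul]; exact hcτ.trans (hτn k))
    (by positivity)
    (by
      have h1 : 1 - (∑ k, (alloc p σ σlow T x k : ℝ)) / T ≤ K / T + D ^ 2 := by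
        have : (T - K - T * D ^ 2) / (T : ℝ) ≤ (∑ k, (alloc p σ σlow T x k : ℝ)) / T := by
          gcongr
        have e : (T - K - T * D ^ 2) / (T : ℝ) = 1 - K / T - D ^ 2 := by field_simp
        linarith
      have h2 : ∑ k, optFrac p s k * ((alloc p σ σlow T x k : ℝ) / (optFrac p s k * T) - 1) ^ 2 ≤
          2 * ((2 + 2 * K) ^ 2 * D ^ 2 + 1 / T) * W := by
        rw [hW, Finset.mul_sum]
        exact Finset.sum_le_sum fun k _ => hwu k
      have hti : (0 : ℝ) ≤ 1 / T := by positivity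
      calc _ ≤ p * (K / T + D ^ 2) + G * (2 * ((2 + 2 * K) ^ 2 * D ^ 2 + 1 / T) * W) := by
            gcongr
        _ = (p * K + 2 * G * W) * (1 / T) + (p + 2 * G * W * (2 + 2 * K) ^ 2) * D ^ 2 := by ring
        _ ≤ (p * K + 2 * G * W) * (1 / T) +
            (p + 2 * G * W * (2 + 2 * K) ^ 2) * (M ^ 2 * K * E) := by gcongr
        _ ≤ _ := by
            have p1 : 0 ≤ (p * K + 2 * G * W) * E := by positivity
            have p2 : 0 ≤ (p + 2 * G * W * (2 + 2 * K) ^ 2) * (M ^ 2 * K) * (1 / T) := by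
              positivity
            rw [hN]
            linarith)
  refine key.trans (le_of_eq ?_)
  ring

end GapBound

end GroupMean

namespace GroupMean

/-! ### Measurability and boundedness of the gap. -/

section Integrability

variable {K : ℕ} {p σ σlow : ℝ} {s : Fin K → ℝ} {T : ℕ}

lemma measurable_weight (p : ℝ) (τ : ℕ) (k : Fin K) :
    Measurable fun x : Fin K → ℕ → ℝ => weight p x τ k := by
  unfold weight sampleVar sampleMean
  fun_prop

/-- The data enter only through a vector of natural numbers, and every function on that discrete
space is measurable. -/
lemma measurable_alloc (k : Fin K) :
    Measurable fun x : Fin K → ℕ → ℝ => alloc p σ σlow T x k := by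
  set τ := phaseOneLength K p σ σlow T with hτ
  let F : (Fin K → ℕ) → ℕ := fun f =>
    (((List.finRange K).flatMap (fun k => List.replicate τ k) ++
      (List.finRange K).flatMap (fun k => List.replicate (f k - τ) k)).take T).count k
  have hF : Measurable F := Measurable.of_discrete
  have hf : Measurable fun (x : Fin K → ℕ → ℝ) (j : Fin K) => ⌊weight p x τ j * T⌋₊ :=
    measurable_pi_lambda _ fun j =>
      Nat.measurable_floor.comp ((measurable_weight p τ j).mul_const (T : ℝ))
  exact hF.comp hf

lemma measurable_gap : Measurable (gap (K := K) p σ σlow s T) := by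
  have h : ∀ k : Fin K, Measurable fun x : Fin K → ℕ → ℝ => (alloc p σ σlow T x k : ℝ) :=
    fun k => measurable_from_nat.comp (measurable_alloc k)
  unfold gap objective
  refine Measurable.sub_const (Measurable.pow_const ?_ _) _
  exact Finset.measurable_fun_sum _ fun k _ => ((h k).const_div _).pow_const _

/-- Counts of at least one bound the objective by its value at the all-ones allocation, so
integrability needs no moments. -/
lemma abs_gap_le (hp : 0 < p) {x : Fin K → ℕ → ℝ} (h : ∀ k, 0 < alloc p σ σlow T x k) :
    |gap p σ σlow s T x| ≤
      (∑ k, (s k ^ 2) ^ p) ^ (1 / p) + |objective p s (optAlloc p s T)| := by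
  have h0 : ∀ k, 0 ≤ (s k ^ 2 / (alloc p σ σlow T x k : ℝ)) ^ p := fun k =>
    Real.rpow_nonneg (by positivity) _
  have h1 : 0 ≤ objective p s (fun k => (alloc p σ σlow T x k : ℝ)) :=
    Real.rpow_nonneg (Finset.sum_nonneg fun k _ => h0 k) _
  have h2 : objective p s (fun k => (alloc p σ σlow T x k : ℝ)) ≤
      (∑ k, (s k ^ 2) ^ p) ^ (1 / p) := by
    unfold objective
    gcongr with k
    exact div_le_self (sq_nonneg _) (Nat.one_le_cast.2 (h k))
  unfold gap
  refine (abs_sub _ _).trans ?_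
  rw [abs_of_nonneg h1]
  gcongr

end Integrability

/-! ### Transfer from laws to random variables. -/

section Expectation

variable {Ω : Type*} [MeasurableSpace Ω] {P : Measure Ω} {ν : Measure ℝ} {Y : Ω → ℝ} {σ : ℝ}

lemma IsSubgaussian.hasSubgaussianMGF (h : IsSubgaussian ν σ) (hY : HasLaw Y ν P) :
    HasSubgaussianMGF (fun ω => Y ω - ∫ z, z ∂ν) (⟨σ ^ 2, sq_nonneg σ⟩ : ℝ≥0) P := by
  unfold IsSubgaussian at h
  -- Freezing the mean keeps it untouched when `ν` is rewritten as a pushforward.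
  generalize (∫ z, z ∂ν) = m at h ⊢
  rw [← hY.map_eq] at h
  exact HasSubgaussianMGF.of_map hY.aemeasurable h

lemma integral_sub_mean_sq (hY : HasLaw Y ν P) :
    ∫ ω, (Y ω - ∫ z, z ∂ν) ^ 2 ∂P = Var[id; ν] := by
  rw [← hY.variance_eq, variance_eq_integral hY.aemeasurable, hY.integral_eq]

end Expectation

/-! ### Expected gap and conclusion. -/

/-- The expected optimality gap is of order `T⁻²`, uniformly in the distributions. -/
lemma integral_gap_le {K : ℕ} (hK : 1 ≤ K) {p : ℝ} (hp : 0 < p) {σ σlow : ℝ} (hσ : 0 < σ)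
    (hlow : 0 < σlow) {s : Fin K → ℝ} (hs : ∀ k, σlow ≤ s k) :
    ∃ C : ℝ, ∀ {Ω : Type*} [MeasurableSpace Ω] (P : Measure Ω) [IsProbabilityMeasure P]
        (ν : Fin K → Measure ℝ) (X : Fin K → ℕ → Ω → ℝ),
        (∀ k, IsSubgaussian (ν k) σ) → (∀ k, Var[id; ν k] = s k ^ 2) →
        (∀ k t, HasLaw (X k t) (ν k) P) → (∀ k, iIndepFun (X k) P) →
        ∀ T : ℕ, 2 ≤ phaseOneLength K p σ σlow T →
          (∀ ω k, 0 < alloc p σ σlow T (fun j t => X j t ω) k) ∧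
          Integrable (fun ω => gap p σ σlow s T (fun k t => X k t ω)) P ∧
          ∫ ω, gap p σ σlow s T (fun k t => X k t ω) ∂P ≤ C / (T : ℝ) ^ 2 := by
  obtain ⟨C, hC0, hC⟩ := gap_le hK hp hσ hlow hs
  have hl0 := phaseOneFrac_pos (p := p) hK hσ hlow
  set c := phaseOneFrac K p σ σlow / 2 with hc
  have hc0 : 0 < c := by positivity
  refine ⟨C * (1 + K * (2400 * (σ ^ 2) ^ 2 / c)), ?_⟩
  intro Ω _ P _ ν X hsub hvar hlaw hind T hτ
  have hX := fun k t => (hsub k).hasSubgaussianMGF (hlaw k t)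
  have hX2 : ∀ k t, ∫ ω, (X k t ω - ∫ z, z ∂ν k) ^ 2 ∂P = s k ^ 2 := fun k t =>
    (integral_sub_mean_sq (hlaw k t)).trans (hvar k)
  have hs0 : ∀ k, 0 < s k := fun k => hlow.trans_le (hs k)
  -- The upper bound on the deviations is a consequence of subgaussianity.
  have hsσ : ∀ k, s k ≤ σ := by
    intro k
    have := second_moment_le (hX k 0)
    rw [hX2] at this
    exact le_of_sq_le_sq this hσ.le
  have hpos : ∀ ω k, 0 < alloc p σ σlow T (fun j t => X j t ω) k := fun ω k =>
    (by omega : 0 < phaseOneLength K p σ σlow T).trans_le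
      (phaseOneLength_le_alloc (mul_phaseOneLength_le hK hp hσ hlow hs hsσ) k)
  have hint : Integrable (fun ω => gap p σ σlow s T (fun k t => X k t ω)) P := by
    refine Integrable.of_bound ?_ _ (ae_of_all _ fun ω => abs_gap_le hp (hpos ω))
    exact (measurable_gap.comp_aemeasurable (aemeasurable_pi_lambda _ fun k =>
      aemeasurable_pi_lambda _ fun t => (hlaw k t).aemeasurable)).aestronglyMeasurable
  refine ⟨hpos, hint, ?_⟩
  set τ := phaseOneLength K p σ σlow T with hτdef
  have hV := fun k => integral_sampleVar_sub_sq_le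
    (c := (⟨σ ^ 2, sq_nonneg σ⟩ : ℝ≥0)) (pow_pos hσ 2) (hind k) (hX k) (hX2 k) hτ
  have hT : 0 < T := by
    rcases Nat.eq_zero_or_pos T with h | h
    · simp [hτdef, phaseOneLength, h] at hτ
    · exact h
  have hT' : (0 : ℝ) < T := by exact_mod_cast hT
  have hcτ : c * T ≤ τ := mul_le_phaseOneLength hτ
  have hsumi : Integrable (fun ω => ∑ k, (sampleVar (fun t => X k t ω) τ - s k ^ 2) ^ 2) P :=
    integrable_finsetSum _ fun k _ => (hV k).1
  calc ∫ ω, gap p σ σlow s T (fun k t => X k t ω) ∂P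
      ≤ ∫ ω, C / T * (1 / T + ∑ k, (sampleVar (fun t => X k t ω) τ - s k ^ 2) ^ 2) ∂P :=
        integral_mono hint (((integrable_const _).add hsumi).const_mul _) fun ω =>
          hC T (fun k t => X k t ω) hsσ hτ
    _ = C / T * (1 / T + ∑ k, ∫ ω, (sampleVar (fun t => X k t ω) τ - s k ^ 2) ^ 2 ∂P) := by
        rw [integral_const_mul, integral_add (integrable_const _) hsumi,
          integral_finsetSum _ fun k _ => (hV k).1]
        simp
    _ ≤ C / T * (1 / T + ∑ _k : Fin K, 2400 * (σ ^ 2) ^ 2 / (c * T)) := by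
        gcongr with k
        refine (hV k).2.trans ?_
        change 2400 * (σ ^ 2) ^ 2 / (τ : ℝ) ≤ _
        gcongr
    _ = C * (1 + K * (2400 * (σ ^ 2) ^ 2 / c)) / (T : ℝ) ^ 2 := by
        rw [Finset.sum_const, Finset.card_univ, Fintype.card_fin, nsmul_eq_mul]
        field_simp

/-- Positivity is all that the final argument needs from this constant. -/
lemma gapConst_pos {K : ℕ} (hK : 1 ≤ K) {p : ℝ} (hp : 0 < p) {σ σlow : ℝ} (hσ : 0 < σ)
    (hlow : 0 < σlow) {s : Fin K → ℝ} (hs : ∀ k, 0 < s k) : 0 < gapConst p σ σlow s := by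
  have h1 := powerSum_pos hK hs (qExp p)
  have h2 := powerSum_pos hK hs (qExp p - 4)
  have h3 := phaseOneFrac_pos (p := p) hK hσ hlow
  unfold gapConst
  positivity

end GroupMean

theorem mainTheorem4 (K : ℕ) (hK : 1 ≤ K) (p : ℝ) (hp : 0 < p)
    (σ σlow : ℝ) (hσ : 0 < σ) (hlow : 0 < σlow)
    (s : Fin K → ℝ) (hs : ∀ k, σlow ≤ s k) :
    ∃ g : ℕ → ℝ, g =o[atTop] (fun T : ℕ => ((T : ℝ) ^ 2)⁻¹) ∧
      ∀ {Ω : Type*} [MeasurableSpace Ω] (P : Measure Ω) [IsProbabilityMeasure P]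
        (ν : Fin K → Measure ℝ) (X : Fin K → ℕ → Ω → ℝ),
        (∀ k, GroupMean.IsSubgaussian (ν k) σ) →
        (∀ k, Var[id; ν k] = s k ^ 2) →
        (∀ k t, HasLaw (X k t) (ν k) P) →
        (∀ k, iIndepFun (X k) P) →
        ∀ T : ℕ, 2 ≤ GroupMean.phaseOneLength K p σ σlow T →
          (∀ ω k, 0 < GroupMean.alloc p σ σlow T (fun j t => X j t ω) k) ∧
          Integrable (fun ω => GroupMean.gap p σ σlow s T (fun k t => X k t ω)) P ∧
          ∫ ω, GroupMean.gap p σ σlow s T (fun k t => X k t ω) ∂P ≤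
            24 * σ ^ 4 * GroupMean.gapConst p σ σlow s * (((T : ℝ) ^ 2)⁻¹ * Real.log T) + g T := by

  obtain ⟨C, hC⟩ := GroupMean.integral_gap_le hK hp hσ hlow hs
  set B := 24 * σ ^ 4 * GroupMean.gapConst p σ σlow s with hB
  have hB0 : 0 < B :=
    mul_pos (by positivity) (GroupMean.gapConst_pos hK hp hσ hlow fun k => hlow.trans_le (hs k))
  -- The positive part is exactly what the logarithmic term fails to cover; it vanishes once `B *
  -- log T ≥ C`, so this `g` is eventually zero.
  refine ⟨fun T => max 0 (C - B * Real.log T) * ((T : ℝ) ^ 2)⁻¹, ?_, ?_⟩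
  · have hlog : Tendsto (fun T : ℕ => B * Real.log T) atTop atTop :=
      (Real.tendsto_log_atTop.comp tendsto_natCast_atTop_atTop).const_mul_atTop hB0
    have hev : (fun T : ℕ => max 0 (C - B * Real.log T) * ((T : ℝ) ^ 2)⁻¹) =ᶠ[atTop]
        fun _ => (0 : ℝ) := by
      filter_upwards [hlog.eventually_ge_atTop C] with T hT
      rw [max_eq_left (by linarith), zero_mul]
    exact hev.trans_isLittleO (isLittleO_zero _ _)
  · intro Ω _ P _ ν X hsub hvar hlaw hind T hτ
    obtain ⟨h1, h2, h3⟩ := hC P ν X hsub hvar hlaw hind T hτ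
    refine ⟨h1, h2, h3.trans ?_⟩
    have h4 : C ≤ B * Real.log T + max 0 (C - B * Real.log T) := by
      linarith [le_max_right 0 (C - B * Real.log T)]
    calc C / (T : ℝ) ^ 2 ≤ (B * Real.log T + max 0 (C - B * Real.log T)) / (T : ℝ) ^ 2 := by
          gcongr
      _ = _ := by rw [div_eq_mul_inv]; ring
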